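/- Let $(\Omega,\mathcal F,\mathbb P)$ be a probability space carrying a one-period market with a riskless asset $S^0_0=1$, $S^0_1=1+r$ for some $r>-1$, and $d$ risky assets with deterministic initial prices $S^1_0,\dots,S^d_0>0$ and real-valued $\mathcal F$-measurable terminal prices $S^1_1,\dots,S^d_1$. Put $R^i=(S^i_1-S^i_0)/S^i_0$. Assume that: - the returns $R^1,\dots,R^d$ are $\mathbb P$-integrable; - the market is nonredundant: if $\sum_{i=0}^d\theta^iS^i_t=0$ $\mathbb P$-a.s. for both $t=0$ and $t=1$, then $\theta^0=\dots=\theta^d=0$; - the market is nondegenerate: $\mathbb E[R^i]\neq r$ for at least one $i\in\{1,\dots,d\}$. A portfolio is a vector $\pi\in\mathbb R^d$; its excess return is $X_\pi=\sum_{i=1}^d\pi^i(R^i-r)$. For $u\in(0,1)$, $\alpha\in(0,1)$ and $X\in L^1(\mathbb P)$ let $$\mathrm{VaR}^u(X)=\inf\{m\in\mathbb R:\mathbb P[m+X<0]\le u\},\qquad \mathrm{ES}^\alpha(X)=\frac1\alpha\int_0^\alpha\mathrm{VaR}^u(X)\,\mathrm du .$$ For $\nu\ge0$ let $\Pi_\nu=\{\pi\in\mathbb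 R^d:\mathbb E[X_\pi]=\nu\}$, and let $\Pi^{\mathrm{ES}^\alpha}_\nu$ be the set of $\mathrm{ES}^\alpha$-optimal portfolios for $\nu$, i.e. of all $\pi\in\Pi_\nu$ such that $\mathrm{ES}^\alpha(X_\pi)\le\mathrm{ES}^\alpha(X_{\pi'})$ for all $\pi'\in\Pi_\nu$. A portfolio $\pi$ is $\mathrm{ES}^\alpha$-efficient if $\mathbb E[X_\pi]\ge0$ and there is no portfolio $\pi'$ with $\mathbb E[X_{\pi'}]\ge\mathbb E[X_\pi]$ and $\mathrm{ES}^\alpha(X_{\pi'})\le\mathrm{ES}^\alpha(X_\pi)$, at least one of the two inequalities being strict. The market admits $\mathrm{ES}^\alpha$-arbitrage if there is no $\mathrm{ES}^\alpha$-efficient portfolio. It admits strong $\mathrm{ES}^\alpha$-arbitrage if for every portfolio $\pi$ there is a portfolio $\pi'$ with $\mathbb E[X_{\pi'}]>\mathbb E[X_\pi]$ and $\mathrm{ES}^\alpha(X_{\pi'})<\mathrm{ES}^\alpha(X_\pi)$. Let $\mathcal M$ be the set of densities of absolutely continuous martingale measures, i.e. of all $Z\in L^1(\mathbb P)$ with $Z\ge0$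 $\mathbb P$-a.s., $\mathbb E[Z]=1$, and, for $i=1,\dots,d$, $Z(R^i-r)\in L^1(\mathbb P)$ and $\mathbb E[Z(R^i-r)]=0$. Let $\mathcal P=\{Z\in\mathcal M: Z>0\ \mathbb P\text{-a.s.}\}$ be the set of densities of equivalent martingale measures (EMMs). **Theorem.** Fix $\alpha\in(0,1)$. Then for every $\nu\ge0$ the set $\Pi^{\mathrm{ES}^\alpha}_\nu$ is nonempty, compact and convex. Moreover: (a) The market does not admit strong $\mathrm{ES}^\alpha$-arbitrage if and only if there exists $Z\in\mathcal M$ with $\|Z\|_\infty\le\frac1\alpha$. (b) The market does not admit $\mathrm{ES}^\alpha$-arbitrage if and only if there exists $Z\in\mathcal P$ with $\|Z\|_\infty<\frac1\alpha$. -/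

import Mathlib

open MeasureTheory

namespace MeanRisk

noncomputable section

/-- A one-period market on `Ω` with a riskless asset, whose price is `1` at time `0` and `1 + r` at
time `1`, and `d` risky assets with deterministic positive prices `S₀ i` at time `0` and random
prices `S₁ i` at time `1`. -/
structure Market (Ω : Type*) [MeasurableSpace Ω] (d : ℕ) where
  /-- riskless rate -/
  r : ℝ
  neg_one_lt_r : -1 < r
  /-- prices of the risky assets at time `0` -/
  S₀ : Fin d → ℝ
  S₀_pos : ∀ i, 0 < S₀ i
  /-- prices of the risky assets at time `1` -/
  S₁ : Fin d → Ω → ℝ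
  measurable_S₁ : ∀ i, Measurable (S₁ i)

variable {Ω : Type*} [MeasurableSpace Ω] {d : ℕ}

namespace Market

/-- The relative return `R^i = (S^i_1 - S^i_0) / S^i_0` of the risky asset `i`. -/
def ret (M : Market Ω d) (i : Fin d) (ω : Ω) : ℝ :=
  (M.S₁ i ω - M.S₀ i) / M.S₀ i

/-- The excess return `X_π = π · (R - r 1)` of the portfolio `π`, where `π i` is the fraction of
wealth invested in the risky asset `i` (and `1 - ∑ i, π i` is invested in the riskless asset). -/
def excess (M : Market Ω d) (π : Fin d → ℝ) (ω : Ω) : ℝ :=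
  ∑ i, π i * (M.ret i ω - M.r)

/-- Nonredundancy: if a combination `θ⁰ S⁰ + ∑ i, θ i S^i` of the price processes vanishes almost
surely (at both times `0` and `1`), then all its coefficients vanish. -/
def Nonredundant (M : Market Ω d) (P : Measure Ω) : Prop :=
  ∀ (θ₀ : ℝ) (θ : Fin d → ℝ),
    θ₀ + ∑ i, θ i * M.S₀ i = 0 →
    (∀ᵐ ω ∂P, θ₀ * (1 + M.r) + ∑ i, θ i * M.S₁ i ω = 0) →
    θ₀ = 0 ∧ ∀ i, θ i = 0

/-- The risky returns are integrable. -/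
def IntegrableReturns (M : Market Ω d) (P : Measure Ω) : Prop :=
  ∀ i, Integrable (M.ret i) P

/-- The risky returns are nondegenerate: some risky asset has an expected return other than `r`. -/
def Nondegenerate (M : Market Ω d) (P : Measure Ω) : Prop :=
  ∃ i, ∫ ω, M.ret i ω ∂P ≠ M.r

/-- `Π_ν`: the portfolios with expected excess return `ν`. -/
def portfolios (M : Market Ω d) (P : Measure Ω) (ν : ℝ) : Set (Fin d → ℝ) :=
  {π | ∫ ω, M.excess π ω ∂P = ν}

/-- `Π^ρ_ν`: the `ρ`-optimal portfolios for `ν`. -/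
def optimalSet (M : Market Ω d) (P : Measure Ω) (ρ : (Ω → ℝ) → EReal) (ν : ℝ) :
    Set (Fin d → ℝ) :=
  {π | π ∈ M.portfolios P ν ∧ ρ (M.excess π) < ⊤ ∧
    ∀ π' ∈ M.portfolios P ν, ρ (M.excess π) ≤ ρ (M.excess π')}

/-- `π` is strictly `ρ`-preferred over `π'`. -/
def StrictlyPreferred (M : Market Ω d) (P : Measure Ω) (ρ : (Ω → ℝ) → EReal)
    (π π' : Fin d → ℝ) : Prop :=
  ∫ ω, M.excess π' ω ∂P ≤ ∫ ω, M.excess π ω ∂P ∧ ρ (M.excess π) ≤ ρ (M.excess π') ∧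
    (∫ ω, M.excess π' ω ∂P < ∫ ω, M.excess π ω ∂P ∨ ρ (M.excess π) < ρ (M.excess π'))

/-- `π` is a `ρ`-efficient portfolio. -/
def Efficient (M : Market Ω d) (P : Measure Ω) (ρ : (Ω → ℝ) → EReal) (π : Fin d → ℝ) : Prop :=
  0 ≤ ∫ ω, M.excess π ω ∂P ∧ ¬ ∃ π' : Fin d → ℝ, M.StrictlyPreferred P ρ π' π

/-- `ρ`-arbitrage: there is no `ρ`-efficient portfolio. -/
def Arbitrage (M : Market Ω d) (P : Measure Ω) (ρ : (Ω → ℝ) → EReal) : Prop :=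
  ¬ ∃ π : Fin d → ℝ, M.Efficient P ρ π

/-- Strong `ρ`-arbitrage: every portfolio is beaten by another one that has both a strictly higher
expected excess return and a strictly lower risk. -/
def StrongArbitrage (M : Market Ω d) (P : Measure Ω) (ρ : (Ω → ℝ) → EReal) : Prop :=
  ∀ π : Fin d → ℝ, ∃ π' : Fin d → ℝ,
    ∫ ω, M.excess π ω ∂P < ∫ ω, M.excess π' ω ∂P ∧ ρ (M.excess π') < ρ (M.excess π)

end Market

/-- Value at Risk at level `u`: `inf {m ∈ ℝ : P[m + X < 0] ≤ u}`. -/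
def VaR (P : Measure Ω) (u : ℝ) (X : Ω → ℝ) : ℝ :=
  sInf {m : ℝ | P.real {ω | m + X ω < 0} ≤ u}

/-- Expected Shortfall at level `α`: `(1/α) ∫_0^α VaR^u(X) du`. It is finite for integrable `X`; it
is cast to `EReal` because risk measures in general take values in `(-∞, ∞]`. -/
def ES (P : Measure Ω) (α : ℝ) (X : Ω → ℝ) : EReal :=
  ((1 / α * ∫ u in (0 : ℝ)..α, VaR P u X : ℝ) : EReal)

/-- `𝒟`: the densities with respect to `P` of the probability measures that are absolutely
continuous with respect to `P`. -/
def densities (P : Measure Ω) : Set (Ω → ℝ) :=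
  {Z | Integrable Z P ∧ (∀ᵐ ω ∂P, 0 ≤ Z ω) ∧ ∫ ω, Z ω ∂P = 1}

/-- `ℳ`: the densities of the absolutely continuous martingale measures of the market. -/
def Market.acmmDensities (M : Market Ω d) (P : Measure Ω) : Set (Ω → ℝ) :=
  {Z | Z ∈ densities P ∧ ∀ i, Integrable (fun ω => Z ω * (M.ret i ω - M.r)) P ∧
    ∫ ω, Z ω * (M.ret i ω - M.r) ∂P = 0}

/-- `𝒫`: the densities of the equivalent martingale measures of the market. -/
def Market.emmDensities (M : Market Ω d) (P : Measure Ω) : Set (Ω → ℝ) :=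
  {Z | Z ∈ M.acmmDensities P ∧ ∀ᵐ ω ∂P, 0 < Z ω}

end

end MeanRisk

/-! By Rockafellar–Uryasev, the Expected Shortfall of `X_π` is the minimum over `m` of `m + 1/α *
E[(-X_π - m)⁺]` (`ES_le`, `ES_eq`). Hence the risk is a sublinear function of `π` that dominates
minus the mean. Since `α < 1` and the market is nonredundant, it is positive on nonzero portfolios
of mean zero. Compactness of the unit sphere makes it coercive along each `Π_ν`, so optimal
portfolios exist and form a compact set.

A nonzero portfolio of risk at most zero has positive mean, so adding it to any portfolio improves
the latter. Thus strong arbitrage means that some risk is negative, and arbitrage that some nonzero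
portfolio has risk at most zero.

Risk is nonnegative iff `-m ≤ 1/α * E[L⁺]` for every loss `L = -X_π - m`. By Hahn–Banach the
functional `-m` then extends to `L¹` under this bound and is represented by a density `0 ≤ Z ≤ 1/α`,
which is a martingale density because it prices `L` at `-m`. For (b), strict positivity leaves a
margin proportional to the norm of `(m, π)`, which pays for keeping the density away from both `0`
and `1/α`. Conversely, `E[1/α * L⁺ - Z * L]` is nonnegative, and for `0 < Z < 1/α` it vanishes only
if `L = 0`. -/

namespace MeanRisk

/-! ### Hahn–Banach and bounded densities -/

/-- The expectation of the positive part is subadditive on `L¹`. -/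
theorem integral_posPart_add_le {Ω : Type*} [MeasurableSpace Ω] {P : Measure Ω}
    (f g : Lp ℝ 1 P) :
    ∫ x, max ((f + g) x) 0 ∂P ≤ ∫ x, max (f x) 0 ∂P + ∫ x, max (g x) 0 ∂P := by
  rw [← integral_add (L1.integrable_coeFn f).pos_part (L1.integrable_coeFn g).pos_part]
  refine integral_mono_ae (L1.integrable_coeFn (f + g)).pos_part
    ((L1.integrable_coeFn f).pos_part.add (L1.integrable_coeFn g).pos_part) ?_
  filter_upwards [Lp.coeFn_add f g] with x hx
  simp only [hx, Pi.add_apply]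
  exact max_le (add_le_add (le_max_left _ _) (le_max_left _ _)) (by positivity)

/-- The expectation of the positive part is positively homogeneous on `L¹`. -/
theorem integral_posPart_smul {Ω : Type*} [MeasurableSpace Ω] {P : Measure Ω} {c : ℝ} (hc : 0 ≤ c)
    (f : Lp ℝ 1 P) :
    ∫ x, max ((c • f) x) 0 ∂P = c * ∫ x, max (f x) 0 ∂P := by
  rw [← integral_const_mul]
  refine integral_congr_ae ?_
  filter_upwards [Lp.coeFn_smul c f] with x hx
  simp only [hx, Pi.smul_apply, smul_eq_mul, mul_max_of_nonneg _ _ hc, mul_zero]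

/-- A linear functional on `L¹` dominated by a multiple of the expectation of the positive part is
represented by a bounded nonnegative density. -/
theorem exists_density_of_le_integral_posPart {Ω : Type*} [MeasurableSpace Ω] {P : Measure Ω}
    [IsFiniteMeasure P] {b : ℝ} (hb : 0 ≤ b) (g : Lp ℝ 1 P →ₗ[ℝ] ℝ)
    (hg : ∀ f : Lp ℝ 1 P, g f ≤ b * ∫ x, max (f x) 0 ∂P) :
    ∃ Z : Ω → ℝ, Integrable Z P ∧ (∀ᵐ x ∂P, 0 ≤ Z x) ∧ (∀ᵐ x ∂P, Z x ≤ b) ∧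
      ∀ f : Lp ℝ 1 P, g f = ∫ x, Z x * f x ∂P := by
  have hpos (f : Lp ℝ 1 P) : ∫ x, max (f x) 0 ∂P ≤ ‖f‖ := by
    rw [L1.norm_eq_integral_norm]
    refine integral_mono (L1.integrable_coeFn f).pos_part (L1.integrable_coeFn f).norm fun x => ?_
    exact max_le (le_abs_self _) (abs_nonneg _)
  have hbound (f : Lp ℝ 1 P) : ‖g f‖ ≤ b * ‖f‖ := by
    rw [Real.norm_eq_abs, abs_le]
    constructor
    · have := (hg (-f)).trans (mul_le_mul_of_nonneg_left (hpos (-f)) hb)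
      rw [map_neg, norm_neg] at this
      linarith
    · exact (hg f).trans (mul_le_mul_of_nonneg_left (hpos f) hb)
  let G : Lp ℝ 1 P →L[ℝ] ℝ := g.mkContinuous b hbound
  have hG (f : Lp ℝ 1 P) : G f = g f := rfl
  -- The inclusion of `L²` into `L¹`, realized as Hölder multiplication by the constant one, so that
  -- the Riesz theorem in `L²` can produce `Z`.
  let one : Lp ℝ 2 P := (memLp_const (1 : ℝ)).toLp _
  let incl : Lp ℝ 2 P →L[ℝ] Lp ℝ 1 P := (ContinuousLinearMap.mul ℝ ℝ).holderL P 2 2 1 one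
  have hincl (f : Lp ℝ 2 P) : incl f =ᵐ[P] f := by
    have h1 := (ContinuousLinearMap.mul ℝ ℝ).coeFn_holder (r := 1) one f
    have h2 : one =ᵐ[P] fun _ => (1 : ℝ) := MemLp.coeFn_toLp _
    filter_upwards [h1, h2] with x hx h2
    change ((ContinuousLinearMap.mul ℝ ℝ).holder 1 one f) x = f x
    rw [hx, h2]
    simp
  let Z : Lp ℝ 2 P := (InnerProductSpace.toDual ℝ (Lp ℝ 2 P)).symm (G ∘L incl)
  have hZ2 (f : Lp ℝ 2 P) : g (incl f) = ∫ x, Z x * f x ∂P := by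
    have : inner ℝ Z f = g (incl f) := by
      simp [Z, InnerProductSpace.toDual_symm_apply, hG]
    rw [← this, L2.inner_def]
    refine integral_congr_ae (.of_forall fun x => ?_)
    simp [mul_comm]
  have hZint : Integrable Z P := (Lp.memLp Z).integrable (by norm_num)
  have hset (c : ℝ) (s : Set Ω) (hs : MeasurableSet s) :
      g (indicatorConstLp 1 hs (measure_ne_top P s) c) = c * ∫ x in s, Z x ∂P := by
    have h1 : incl (indicatorConstLp 2 hs (measure_ne_top P s) c) =
        indicatorConstLp 1 hs (measure_ne_top P s) c := by
      refine Lp.ext ((hincl _).trans ?_)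
      exact indicatorConstLp_coeFn.trans indicatorConstLp_coeFn.symm
    rw [← h1, hZ2, ← integral_indicator hs, ← integral_const_mul]
    refine integral_congr_ae ?_
    filter_upwards [indicatorConstLp_coeFn (p := 2) (hs := hs) (hμs := measure_ne_top P s) (c := c)]
      with x hx
    rw [hx]
    by_cases hxs : x ∈ s <;> simp [hxs, mul_comm]
  -- Taking `c = -1` will give `0 ≤ Z`, and `c = 1` will give `Z ≤ b`.
  have hset_pos (c : ℝ) (s : Set Ω) (hs : MeasurableSet s) :
      c * ∫ x in s, Z x ∂P ≤ b * (max c 0 * P.real s) := by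
    rw [← hset c s hs]
    refine (hg _).trans_eq ?_
    have h1 : (fun x => max (indicatorConstLp 1 hs (measure_ne_top P s) c x) 0)
        =ᵐ[P] s.indicator fun _ => max c 0 := by
      filter_upwards [indicatorConstLp_coeFn (p := 1) (hs := hs) (hμs := measure_ne_top P s)
        (c := c)] with x hx
      rw [hx]
      by_cases hxs : x ∈ s <;> simp [hxs]
    rw [integral_congr_ae h1, integral_indicator hs, setIntegral_const, smul_eq_mul,
      mul_comm (P.real s)]
  have hZ0 : ∀ᵐ x ∂P, 0 ≤ Z x := by
    refine ae_nonneg_of_forall_setIntegral_nonneg hZint fun s hs _ => ?_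
    have := hset_pos (-1) s hs
    rw [max_eq_right (by norm_num), zero_mul, mul_zero] at this
    linarith
  have hZb : ∀ᵐ x ∂P, Z x ≤ b := by
    refine ae_le_of_forall_setIntegral_le hZint (integrable_const b) fun s hs _ => ?_
    have := hset_pos 1 s hs
    rw [max_eq_left (by norm_num), one_mul, one_mul] at this
    rw [setIntegral_const, smul_eq_mul, mul_comm]
    exact this
  refine ⟨Z, hZint, hZ0, hZb, ?_⟩
  have hint (f : Lp ℝ 1 P) : Integrable (fun x => Z x * f x) P :=
    (L1.integrable_coeFn f).bdd_mul hZint.aestronglyMeasurable (c := b) (by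
      filter_upwards [hZ0, hZb] with x h0 h1
      rwa [Real.norm_eq_abs, abs_of_nonneg h0])
  let T : Lp ℝ 1 P →ₗ[ℝ] ℝ :=
    { toFun := fun f => ∫ x, Z x * f x ∂P
      map_add' := fun f h => by
        rw [← integral_add (hint f) (hint h)]
        refine integral_congr_ae ?_
        filter_upwards [Lp.coeFn_add f h] with x hx
        simp only [hx, Pi.add_apply, mul_add]
      map_smul' := fun c f => by
        rw [RingHom.id_apply, smul_eq_mul, ← integral_const_mul]
        refine integral_congr_ae ?_
        filter_upwards [Lp.coeFn_smul c f] with x hx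
        simp only [hx, Pi.smul_apply, smul_eq_mul]
        ring }
  have hT (f : Lp ℝ 1 P) : ‖T f‖ ≤ b * ‖f‖ := by
    rw [L1.norm_eq_integral_norm, ← integral_const_mul]
    refine norm_integral_le_of_norm_le ((L1.integrable_coeFn f).norm.const_mul b) ?_
    filter_upwards [hZ0, hZb] with x h0 h1
    rw [norm_mul, Real.norm_eq_abs (Z x), abs_of_nonneg h0]
    exact mul_le_mul_of_nonneg_right h1 (norm_nonneg _)
  -- Both functionals are continuous on `L¹`, so agreement on indicators suffices.
  refine Lp.induction (by norm_num) (fun f => g f = T f) ?_ ?_ ?_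
  · intro c s hs hμs
    rw [Lp.simpleFunc.coe_indicatorConst, hset, ← integral_const_mul, ← integral_indicator hs]
    refine integral_congr_ae ?_
    filter_upwards [indicatorConstLp_coeFn (p := 1) (hs := hs) (hμs := measure_ne_top P s)
      (c := c)] with x hx
    rw [hx]
    by_cases hxs : x ∈ s <;> simp [hxs, mul_comm]
  · intro f h hf hh _ h1 h2
    rw [map_add, map_add, h1, h2]
  · exact isClosed_eq G.continuous (T.mkContinuous b hT).continuous

/-- Domination by a multiple of the expectation of the positive part, on the range of a linear map
into `L¹`, yields a representing bounded nonnegative density. -/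
theorem exists_density_of_forall_le {Ω : Type*} [MeasurableSpace Ω] {P : Measure Ω}
    [IsFiniteMeasure P] {V : Type*} [AddCommGroup V] [Module ℝ V] (W : V →ₗ[ℝ] Lp ℝ 1 P)
    (l : V →ₗ[ℝ] ℝ) {b : ℝ} (hb : 0 ≤ b) (h : ∀ v, l v ≤ b * ∫ x, max (W v x) 0 ∂P) :
    ∃ Z : Ω → ℝ, Integrable Z P ∧ (∀ᵐ x ∂P, 0 ≤ Z x) ∧ (∀ᵐ x ∂P, Z x ≤ b) ∧
      ∀ v, ∫ x, Z x * W v x ∂P = l v := by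
  -- Working on `V × L¹` avoids having to show that `l` factors through `W`. The dominating function
  -- `b * E[(W v + f)⁺]` vanishes at `±(v, -W v)`, so the extension does too, whence `l v = G (0, W
  -- v)`.
  let S : Submodule ℝ (V × Lp ℝ 1 P) := Submodule.prod ⊤ ⊥
  let T : V × Lp ℝ 1 P →ₗ[ℝ] Lp ℝ 1 P := W.coprod LinearMap.id
  obtain ⟨G, hG, hGle⟩ := exists_extension_of_le_sublinear
    (LinearPMap.mk S ((l ∘ₗ LinearMap.fst ℝ V (Lp ℝ 1 P)) ∘ₗ S.subtype))
    (fun v => b * ∫ x, max (T v x) 0 ∂P)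
    (fun c hc v => by
      rw [map_smul, integral_posPart_smul hc.le]; ring)
    (fun v w => by
      rw [map_add, ← mul_add]
      exact mul_le_mul_of_nonneg_left (integral_posPart_add_le _ _) hb)
    (by
      rintro ⟨⟨v, w⟩, hv⟩
      obtain rfl : w = 0 := (Submodule.mem_prod.1 hv).2
      simpa [T] using h v)
  have hGl (v : V) : G (v, 0) = l v := hG ⟨(v, 0), by simp [S]⟩
  have hker (v : V) : G (v, -W v) ≤ 0 := by
    refine (hGle _).trans_eq ?_
    have hT : T (v, -W v) = 0 := by simp [T]
    have h0 : (fun x => max (T (v, -W v) x) 0) =ᵐ[P] fun _ => 0 := by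
      rw [hT]
      filter_upwards [Lp.coeFn_zero ℝ 1 P] with x hx
      rw [hx, Pi.zero_apply, max_self]
    rw [integral_congr_ae h0]
    simp
  have hsplit (v : V) : G (v, -W v) = l v - G (0, W v) := by
    rw [← hGl, ← map_sub]
    simp
  obtain ⟨Z, hZ, h0, hZb, hrep⟩ := exists_density_of_le_integral_posPart (P := P) hb
    (G ∘ₗ LinearMap.inr ℝ V (Lp ℝ 1 P)) (fun f => by simpa [T] using hGle (0, f))
  refine ⟨Z, hZ, h0, hZb, fun v => ?_⟩
  rw [← hrep]
  change G (0, W v) = l v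
  have h1 := hker v
  have h2 := hker (-v)
  have h3 : G (-v, -W (-v)) = -G (v, -W v) := by
    rw [← map_neg G, map_neg W, Prod.neg_mk]
  rw [h3] at h2
  have := hsplit v
  linarith

/-- A linear family of integrable functions, as a linear map into `L¹`. -/
noncomputable def toL1Lin {Ω : Type*} [MeasurableSpace Ω] {P : Measure Ω} {V : Type*}
    [AddCommGroup V] [Module ℝ V] (W : V →ₗ[ℝ] (Ω → ℝ)) (hW : ∀ v, Integrable (W v) P) :
    V →ₗ[ℝ] Lp ℝ 1 P where
  toFun v := (hW v).toL1 (W v)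
  map_add' v w := by
    simp only [map_add]
    exact Integrable.toL1_add _ _ _ _
  map_smul' c v := by
    simp only [map_smul]
    exact Integrable.toL1_smul (W v) (hW v) c

theorem exists_density_of_forall_integral_le {Ω : Type*} [MeasurableSpace Ω] {P : Measure Ω}
    [IsFiniteMeasure P] {V : Type*} [AddCommGroup V] [Module ℝ V] (W : V →ₗ[ℝ] (Ω → ℝ))
    (hW : ∀ v, Integrable (W v) P) (l : V →ₗ[ℝ] ℝ) {b : ℝ} (hb : 0 ≤ b)
    (h : ∀ v, l v ≤ b * ∫ x, max (W v x) 0 ∂P) :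
    ∃ Z : Ω → ℝ, Integrable Z P ∧ (∀ᵐ x ∂P, 0 ≤ Z x) ∧ (∀ᵐ x ∂P, Z x ≤ b) ∧
      ∀ v, ∫ x, Z x * W v x ∂P = l v := by
  have hcoe (v : V) : toL1Lin W hW v =ᵐ[P] W v := Integrable.coeFn_toL1 (hW v)
  obtain ⟨Z, hZ, h0, hZb, hrep⟩ := exists_density_of_forall_le (toL1Lin W hW) l hb fun v => by
    refine (h v).trans_eq ?_
    congr 1
    refine integral_congr_ae ?_
    filter_upwards [hcoe v] with x hx
    rw [hx]
  refine ⟨Z, hZ, h0, hZb, fun v => (integral_congr_ae ?_).trans (hrep v)⟩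
  filter_upwards [hcoe v] with x hx
  rw [hx]

/-! ### Value at Risk as a quantile function -/

open Set Filter ProbabilityTheory Topology

section Quantile

variable {Ω : Type*} [MeasurableSpace Ω] {P : Measure Ω} [IsProbabilityMeasure P] {X : Ω → ℝ}

/-- The probability of `m + X < 0` in terms of the distribution function of `-X`. -/
theorem measureReal_add_neg_eq (hX : Measurable X) (m : ℝ) :
    P.real {ω | m + X ω < 0} = 1 - cdf (P.map fun ω => -X ω) m := by
  have : IsProbabilityMeasure (P.map fun ω => -X ω) :=
    Measure.isProbabilityMeasure_map hX.neg.aemeasurable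
  have hXn : Measurable fun ω => -X ω := hX.neg
  rw [cdf_eq_real, map_measureReal_apply hXn measurableSet_Iic,
    ← probReal_compl_eq_one_sub (hXn measurableSet_Iic)]
  congr 1
  ext ω
  simp only [mem_ofPred_eq, mem_compl_iff, mem_preimage, mem_Iic, not_le]
  constructor <;> intro h <;> linarith

/-- Value at Risk is a generalized inverse of the tail function of the loss. -/
theorem VaR_le_iff (hX : Measurable X) {u : ℝ} (hu : u ∈ Ioo (0 : ℝ) 1) (m : ℝ) :
    VaR P u X ≤ m ↔ 1 - cdf (P.map fun ω => -X ω) m ≤ u := by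
  set F := cdf (P.map fun ω => -X ω)
  have hS : {m : ℝ | P.real {ω | m + X ω < 0} ≤ u} = {m | 1 - u ≤ F m} := by
    ext m
    rw [mem_ofPred_eq, measureReal_add_neg_eq hX, mem_ofPred_eq, sub_le_comm]
  -- `0 < u` makes the set nonempty and `u < 1` bounds it below, so the real `sInf` is a true
  -- infimum; right continuity of `F` makes it attained.
  have hne : {m | 1 - u ≤ F m}.Nonempty :=
    (((tendsto_cdf_atTop _).eventually (lt_mem_nhds (by linarith [hu.1] : 1 - u < 1))).exists).imp
      fun _ h => le_of_lt h
  have hbdd : BddBelow {m | 1 - u ≤ F m} := by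
    obtain ⟨a, ha⟩ := ((tendsto_cdf_atBot (P.map fun ω => -X ω)).eventually
      (gt_mem_nhds (by linarith [hu.2] : 0 < 1 - u))).exists
    refine ⟨a, fun m hm => ?_⟩
    by_contra! hlt
    exact absurd (le_trans hm (F.mono hlt.le)) (not_le.2 ha)
  have hmem : 1 - u ≤ F (sInf {m | 1 - u ≤ F m}) := by
    refine ge_of_tendsto ((F.right_continuous _).tendsto.mono_left
      (nhdsWithin_mono _ Ioi_subset_Ici_self)) ?_
    filter_upwards [self_mem_nhdsWithin] with y hy
    obtain ⟨m, hm, hmy⟩ := exists_lt_of_csInf_lt hne hy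
    exact le_trans hm (F.mono hmy.le)
  rw [VaR, hS, sub_le_comm]
  exact ⟨fun h => hmem.trans (F.mono h), fun h => csInf_le hbdd h⟩

/-- Value at Risk is nonincreasing in the level. -/
theorem antitoneOn_VaR (hX : Measurable X) : AntitoneOn (fun u => VaR P u X) (Ioo 0 1) := by
  intro u hu v hv huv
  exact (VaR_le_iff hX hv _).2 (((VaR_le_iff hX hu _).1 le_rfl).trans huv)

theorem aemeasurable_VaR (hX : Measurable X) :
    AEMeasurable (fun u => VaR P u X) (volume.restrict (Ioo 0 1)) :=
  aemeasurable_restrict_of_antitoneOn measurableSet_Ioo (antitoneOn_VaR hX)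

/-- Under the uniform distribution of the level, Value at Risk has the law of the loss. -/
theorem map_VaR (hX : Measurable X) :
    (volume.restrict (Ioo (0 : ℝ) 1)).map (fun u => VaR P u X) = P.map fun ω => -X ω := by
  have : IsProbabilityMeasure (P.map fun ω => -X ω) :=
    Measure.isProbabilityMeasure_map hX.neg.aemeasurable
  have : IsFiniteMeasure ((volume.restrict (Ioo (0 : ℝ) 1)).map fun u => VaR P u X) :=
    Measure.isFiniteMeasure_map _ _
  refine Measure.ext_of_Iic _ _ fun m => ?_
  rw [Measure.map_apply_of_aemeasurable (aemeasurable_VaR hX) measurableSet_Iic,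
    Measure.restrict_apply₀' measurableSet_Ioo.nullMeasurableSet, ← ofReal_cdf]
  have h0 := cdf_nonneg (P.map fun ω => -X ω) m
  have h1 := cdf_le_one (P.map fun ω => -X ω) m
  set c := cdf (P.map fun ω => -X ω) m
  have hset : (fun u => VaR P u X) ⁻¹' Iic m ∩ Ioo 0 1 = Ici (1 - c) ∩ Ioo 0 1 := by
    ext u
    simp only [mem_inter_iff, and_congr_left_iff, mem_preimage, mem_Iic, mem_Ici]
    exact fun hu => VaR_le_iff hX hu m
  rw [hset]
  -- The set lies between `Ioo (1 - c) 1` and `Icc (1 - c) 1`, both of length `c`.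
  apply le_antisymm
  · refine (measure_mono (t := Icc (1 - c) 1) fun u hu => ⟨hu.1, hu.2.2.le⟩).trans_eq ?_
    rw [Real.volume_Icc, sub_sub_cancel]
  · refine le_trans (le_of_eq ?_) (measure_mono (s := Ioo (1 - c) 1) fun u hu =>
      ⟨hu.1.le, by linarith [hu.1], hu.2⟩)
    rw [Real.volume_Ioo, sub_sub_cancel]

theorem integrableOn_VaR (hX : Measurable X) (hXi : Integrable X P) :
    IntegrableOn (fun u => VaR P u X) (Ioo 0 1) := by
  have h : Integrable id (P.map fun ω => -X ω) :=
    (integrable_map_measure (by fun_prop) hX.neg.aemeasurable).2 hXi.neg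
  rw [← map_VaR hX] at h
  exact (integrable_map_measure (by fun_prop) (aemeasurable_VaR hX)).1 h

theorem integral_posPart_VaR_sub (hX : Measurable X) (m : ℝ) :
    ∫ u in Ioo 0 1, max (VaR P u X - m) 0 = ∫ ω, max (-X ω - m) 0 ∂P := by
  have hm : Measurable fun x : ℝ => max (x - m) 0 := by fun_prop
  have hXn : Measurable fun ω => -X ω := hX.neg
  rw [← integral_map (f := fun x : ℝ => max (x - m) 0) (aemeasurable_VaR hX)
    hm.aestronglyMeasurable, map_VaR hX,
    integral_map hXn.aemeasurable hm.aestronglyMeasurable]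

end Quantile

/-! ### The Rockafellar–Uryasev formula -/

section ExpectedShortfall

variable {Ω : Type*} [MeasurableSpace Ω] {P : Measure Ω} [IsProbabilityMeasure P] {X : Ω → ℝ}
  {α : ℝ}

theorem integral_VaR_sub (hX : Measurable X) (hXi : Integrable X P) (hα₀ : 0 < α) (hα₁ : α < 1)
    (m : ℝ) :
    ∫ u in (0 : ℝ)..α, VaR P u X = α * m + ∫ u in Ioo 0 α, (VaR P u X - m) := by
  have hsub : Ioo 0 α ⊆ Ioo 0 1 := Ioo_subset_Ioo_right hα₁.le
  rw [intervalIntegral.integral_of_le hα₀.le, integral_Ioc_eq_integral_Ioo,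
    integral_sub ((integrableOn_VaR hX hXi).mono_set hsub) (integrable_const _)]
  simp [hα₀.le]

/-- The Rockafellar–Uryasev bound for Expected Shortfall. -/
theorem ES_le (hX : Measurable X) (hXi : Integrable X P) (hα₀ : 0 < α) (hα₁ : α < 1) (m : ℝ) :
    1 / α * ∫ u in (0 : ℝ)..α, VaR P u X ≤ m + 1 / α * ∫ ω, max (-X ω - m) 0 ∂P := by
  have hsub : Ioo 0 α ⊆ Ioo 0 1 := Ioo_subset_Ioo_right hα₁.le
  have hi : IntegrableOn (fun u => VaR P u X - m) (Ioo 0 1) :=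
    (integrableOn_VaR hX hXi).sub (integrable_const _)
  have h1 : ∫ u in Ioo 0 α, (VaR P u X - m) ≤ ∫ ω, max (-X ω - m) 0 ∂P := by
    rw [← integral_posPart_VaR_sub hX]
    refine (integral_mono (hi.mono_set hsub) (IntegrableOn.mono_set hi.pos_part hsub)
      fun u => le_max_left _ _).trans ?_
    exact setIntegral_mono_set hi.pos_part (.of_forall fun u => le_max_right _ _)
      (.of_forall hsub)
  rw [integral_VaR_sub hX hXi hα₀ hα₁ m, mul_add, one_div, inv_mul_cancel_left₀ hα₀.ne']
  gcongr

/-- The Rockafellar–Uryasev formula: the minimum is attained at Value at Risk. -/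
theorem ES_eq (hX : Measurable X) (hXi : Integrable X P) (hα₀ : 0 < α) (hα₁ : α < 1) :
    1 / α * ∫ u in (0 : ℝ)..α, VaR P u X =
      VaR P α X + 1 / α * ∫ ω, max (-X ω - VaR P α X) 0 ∂P := by
  have hsub : Ioo 0 α ⊆ Ioo 0 1 := Ioo_subset_Ioo_right hα₁.le
  -- By monotonicity in `u`, the difference is nonnegative before `α` and nonpositive after it, so
  -- integrating over `(0, α)` is integrating the positive part over `(0, 1)`.
  have h1 : ∫ u in Ioo 0 α, (VaR P u X - VaR P α X) = ∫ ω, max (-X ω - VaR P α X) 0 ∂P := by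
    rw [← integral_posPart_VaR_sub hX]
    refine Eq.trans (setIntegral_congr_fun measurableSet_Ioo fun u hu => ?_)
      (setIntegral_eq_of_subset_of_forall_sdiff_eq_zero measurableSet_Ioo hsub
        fun u hu => ?_).symm
    · exact (max_eq_left (sub_nonneg.2
        (antitoneOn_VaR hX (hsub hu) ⟨hα₀, hα₁⟩ hu.2.le))).symm
    · refine max_eq_right (sub_nonpos.2 (antitoneOn_VaR hX ⟨hα₀, hα₁⟩ hu.1 ?_))
      by_contra! hlt
      exact hu.2 ⟨hu.1.1, hlt⟩
  rw [integral_VaR_sub hX hXi hα₀ hα₁ (VaR P α X), mul_add, h1, one_div,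
    inv_mul_cancel_left₀ hα₀.ne']

end ExpectedShortfall

/-! ### Sublinear functions in finite dimension -/

section Sublinear

variable {E : Type*} [NormedAddCommGroup E] [NormedSpace ℝ E] {f : E → ℝ}

/-- A sublinear function is convex. -/
theorem convexOn_of_sublinear (hadd : ∀ x y, f (x + y) ≤ f x + f y)
    (hsmul : ∀ c : ℝ, 0 ≤ c → ∀ x, f (c • x) = c * f x) : ConvexOn ℝ univ f := by
  refine ⟨convex_univ, fun x _ y _ a b ha hb _ => (hadd _ _).trans_eq ?_⟩
  rw [hsmul a ha, hsmul b hb, smul_eq_mul, smul_eq_mul]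

/-- A sublinear function on a finite-dimensional space is continuous. -/
theorem continuous_of_sublinear [FiniteDimensional ℝ E] (hadd : ∀ x y, f (x + y) ≤ f x + f y)
    (hsmul : ∀ c : ℝ, 0 ≤ c → ∀ x, f (c • x) = c * f x) : Continuous f :=
  continuousOn_univ.1 ((convexOn_of_sublinear hadd hsmul).continuousOn isOpen_univ)

/-- A sublinear function that is positive on the nonzero vectors of a subspace of a
finite-dimensional space dominates a positive multiple of the norm there. -/
theorem exists_mul_norm_le_of_sublinear [FiniteDimensional ℝ E]
    (hadd : ∀ x y, f (x + y) ≤ f x + f y) (hsmul : ∀ c : ℝ, 0 ≤ c → ∀ x, f (c • x) = c * f x)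
    (S : Submodule ℝ E) (hpos : ∀ x ∈ S, x ≠ 0 → 0 < f x) :
    ∃ c : ℝ, 0 < c ∧ ∀ x ∈ S, c * ‖x‖ ≤ f x := by
  have hcomp : IsCompact ((S : Set E) ∩ Metric.sphere 0 1) :=
    (isCompact_sphere 0 1).inter_left S.closed_of_finiteDimensional
  have h0 : f 0 = 0 := by simpa using hsmul 0 le_rfl 0
  -- If `S` is trivial any constant serves; otherwise `c` is the minimum of `f` on the unit sphere
  -- of `S`.
  rcases ((S : Set E) ∩ Metric.sphere 0 1).eq_empty_or_nonempty with hemp | hne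
  · refine ⟨1, one_pos, fun x hx => ?_⟩
    rcases eq_or_ne x 0 with rfl | hx0
    · simp [h0]
    · have hmem : ‖x‖⁻¹ • x ∈ (S : Set E) ∩ Metric.sphere 0 1 :=
        ⟨S.smul_mem _ hx, by simp [norm_smul, hx0]⟩
      rw [hemp] at hmem
      exact hmem.elim
  · obtain ⟨y, hy, hmin⟩ := hcomp.exists_isMinOn hne
      (continuous_of_sublinear hadd hsmul).continuousOn
    refine ⟨f y, hpos y hy.1 (by rintro rfl; simpa using hy.2), fun x hx => ?_⟩
    rcases eq_or_ne x 0 with rfl | hx0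
    · simp [h0]
    · have hmem : ‖x‖⁻¹ • x ∈ (S : Set E) ∩ Metric.sphere 0 1 :=
        ⟨S.smul_mem _ hx, by simp [norm_smul, hx0]⟩
      have h1 : f y ≤ f (‖x‖⁻¹ • x) := hmin hmem
      rw [hsmul _ (by positivity)] at h1
      have hn : 0 < ‖x‖ := norm_pos_iff.2 hx0
      calc f y * ‖x‖ ≤ ‖x‖⁻¹ * f x * ‖x‖ := by gcongr
        _ = f x := by field_simp

end Sublinear

/-! ### The risk as a sublinear function of the portfolio -/

section Loss

variable {Ω : Type*} [MeasurableSpace Ω] {P : Measure Ω}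

theorem integral_max_add_le {f g : Ω → ℝ} (hf : Integrable f P) (hg : Integrable g P) :
    ∫ x, max ((f + g) x) 0 ∂P ≤ ∫ x, max (f x) 0 ∂P + ∫ x, max (g x) 0 ∂P := by
  rw [← integral_add hf.pos_part hg.pos_part]
  refine integral_mono (hf.add hg).pos_part (hf.pos_part.add hg.pos_part) fun x => ?_
  exact max_le (add_le_add (le_max_left _ _) (le_max_left _ _)) (by positivity)

theorem integral_max_smul {c : ℝ} (hc : 0 ≤ c) (f : Ω → ℝ) :
    ∫ x, max ((c • f) x) 0 ∂P = c * ∫ x, max (f x) 0 ∂P := by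
  rw [← integral_const_mul]
  simp only [Pi.smul_apply, smul_eq_mul, mul_max_of_nonneg _ _ hc, mul_zero]

variable {d : ℕ} (M : Market Ω d)

/-- The excess return as a linear function of the portfolio. -/
noncomputable def Market.excessLin : (Fin d → ℝ) →ₗ[ℝ] (Ω → ℝ) where
  toFun := M.excess
  map_add' π π' := by
    ext ω
    simp [Market.excess, add_mul, Finset.sum_add_distrib]
  map_smul' c π := by
    ext ω
    simp [Market.excess, Finset.mul_sum, mul_assoc]

/-- The loss `-X_π - m` as a linear function of the pair `(m, π)`. -/
noncomputable def Market.loss : (ℝ × (Fin d → ℝ)) →ₗ[ℝ] (Ω → ℝ) where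
  toFun v ω := -M.excess v.2 ω - v.1
  map_add' v w := by
    ext ω
    have := congrFun (M.excessLin.map_add v.2 w.2) ω
    simp only [Market.excessLin, LinearMap.coe_mk, AddHom.coe_mk, Pi.add_apply] at this
    simp only [Prod.snd_add, this, Prod.fst_add, Pi.add_apply]
    ring
  map_smul' c v := by
    ext ω
    have := congrFun (M.excessLin.map_smul c v.2) ω
    simp only [Market.excessLin, LinearMap.coe_mk, AddHom.coe_mk, Pi.smul_apply,
      smul_eq_mul] at this
    simp only [Prod.smul_snd, this, Prod.smul_fst, Pi.smul_apply, smul_eq_mul, RingHom.id_apply]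
    ring

/-- The mean excess return as a linear functional of the portfolio. -/
noncomputable def Market.mean (P : Measure Ω) : (Fin d → ℝ) →ₗ[ℝ] ℝ :=
  ∑ i, (∫ ω, (M.ret i ω - M.r) ∂P) • LinearMap.proj i

/-- The Expected Shortfall of the excess return of a portfolio, as a real number. -/
noncomputable def Market.risk (P : Measure Ω) (α : ℝ) (π : Fin d → ℝ) : ℝ :=
  1 / α * ∫ u in (0 : ℝ)..α, VaR P u (M.excess π)

/-- The Rockafellar–Uryasev objective as a function of the pair `(m, π)`. -/
noncomputable def Market.objective (P : Measure Ω) (α : ℝ) (v : ℝ × (Fin d → ℝ)) : ℝ :=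
  v.1 + 1 / α * ∫ ω, max (M.loss v ω) 0 ∂P

variable {M} {α : ℝ}

theorem Market.ES_excess (π : Fin d → ℝ) : ES P α (M.excess π) = (M.risk P α π : EReal) := rfl

theorem Market.measurable_excess (π : Fin d → ℝ) : Measurable (M.excess π) := by
  have h := M.measurable_S₁
  unfold Market.excess Market.ret
  fun_prop

/-- In a nonredundant market, only the zero portfolio has vanishing excess return. -/
theorem Market.Nonredundant.eq_zero (h : M.Nonredundant P) {π : Fin d → ℝ}
    (hπ : ∀ᵐ ω ∂P, M.excess π ω = 0) : π = 0 := by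
  -- Share holdings of the self-financed position: it costs zero at time `0` and is worth `X_π` at
  -- time `1`.
  have h1 := h (-∑ i, π i) (fun i => π i / M.S₀ i)
    (by simp [div_mul_cancel₀ _ (M.S₀_pos _).ne'])
    (by
      filter_upwards [hπ] with ω hω
      rw [← hω, Market.excess, neg_mul, Finset.sum_mul, ← Finset.sum_neg_distrib,
        ← Finset.sum_add_distrib]
      refine Finset.sum_congr rfl fun i _ => ?_
      have := (M.S₀_pos i).ne'
      rw [Market.ret]
      field_simp
      ring)
  ext i
  exact (div_eq_zero_iff.1 (h1.2 i)).resolve_right (M.S₀_pos i).ne'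

theorem Market.objective_smul {c : ℝ} (hc : 0 ≤ c) (v : ℝ × (Fin d → ℝ)) :
    M.objective P α (c • v) = c * M.objective P α v := by
  simp only [Market.objective, map_smul, Prod.smul_fst, integral_max_smul hc, smul_eq_mul]
  ring

variable [IsProbabilityMeasure P]

theorem Market.IntegrableReturns.excess (hint : M.IntegrableReturns P) (π : Fin d → ℝ) :
    Integrable (M.excess π) P :=
  integrable_finsetSum _ fun i _ => ((hint i).sub (integrable_const _)).const_mul _

theorem Market.IntegrableReturns.loss (hint : M.IntegrableReturns P) (v : ℝ × (Fin d → ℝ)) :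
    Integrable (M.loss v) P :=
  (hint.excess v.2).neg.sub (integrable_const _)

theorem Market.IntegrableReturns.integral_excess (hint : M.IntegrableReturns P)
    (π : Fin d → ℝ) : ∫ ω, M.excess π ω ∂P = M.mean P π := by
  unfold Market.excess
  have h (i : Fin d) : Integrable (fun ω => π i * (M.ret i ω - M.r)) P :=
    ((hint i).sub (integrable_const _)).const_mul _
  rw [integral_finsetSum _ fun i _ => h i]
  simp [Market.mean, integral_const_mul, mul_comm]

theorem Market.IntegrableReturns.integral_loss (hint : M.IntegrableReturns P)
    (v : ℝ × (Fin d → ℝ)) : ∫ ω, M.loss v ω ∂P = -M.mean P v.2 - v.1 := by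
  change ∫ ω, (-M.excess v.2 ω - v.1) ∂P = _
  have h : Integrable (fun ω => -M.excess v.2 ω) P := (hint.excess _).neg
  rw [integral_sub h (integrable_const _), integral_neg, hint.integral_excess]
  simp

theorem Market.IntegrableReturns.objective_add_le (hint : M.IntegrableReturns P) (hα₀ : 0 < α)
    (v w : ℝ × (Fin d → ℝ)) :
    M.objective P α (v + w) ≤ M.objective P α v + M.objective P α w := by
  have h := mul_le_mul_of_nonneg_left (integral_max_add_le (hint.loss v) (hint.loss w))
    (one_div_nonneg.2 hα₀.le)
  simp only [Market.objective, map_add, Prod.fst_add]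
  linarith

section Risk

variable (hint : M.IntegrableReturns P) (hα₀ : 0 < α) (hα₁ : α < 1)
include hint hα₀ hα₁

/-- With `exists_objective_eq_risk`, this makes the risk the minimum over `m` of a jointly sublinear
objective, so that it inherits sublinearity. -/
theorem Market.risk_le_objective (v : ℝ × (Fin d → ℝ)) : M.risk P α v.2 ≤ M.objective P α v :=
  ES_le (M.measurable_excess v.2) (hint.excess v.2) hα₀ hα₁ v.1

theorem Market.exists_objective_eq_risk (π : Fin d → ℝ) :
    ∃ m, M.objective P α (m, π) = M.risk P α π :=
  ⟨_, (ES_eq (M.measurable_excess π) (hint.excess π) hα₀ hα₁).symm⟩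

theorem Market.risk_add_le (π π' : Fin d → ℝ) :
    M.risk P α (π + π') ≤ M.risk P α π + M.risk P α π' := by
  obtain ⟨m, hm⟩ := M.exists_objective_eq_risk hint hα₀ hα₁ π
  obtain ⟨m', hm'⟩ := M.exists_objective_eq_risk hint hα₀ hα₁ π'
  rw [← hm, ← hm']
  exact (M.risk_le_objective hint hα₀ hα₁ ((m, π) + (m', π'))).trans
    (hint.objective_add_le hα₀ _ _)

/-- Expected Shortfall dominates the mean loss. -/
theorem Market.neg_mean_le_risk (π : Fin d → ℝ) : -M.mean P π ≤ M.risk P α π := by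
  obtain ⟨m, hm⟩ := M.exists_objective_eq_risk hint hα₀ hα₁ π
  have h1 : ∫ ω, M.loss (m, π) ω ∂P ≤ ∫ ω, max (M.loss (m, π) ω) 0 ∂P :=
    integral_mono (hint.loss _) (hint.loss _).pos_part fun ω => le_max_left _ _
  have h2 : 0 ≤ ∫ ω, max (M.loss (m, π) ω) 0 ∂P := integral_nonneg fun ω => le_max_right _ _
  have h3 : 1 ≤ 1 / α := (one_le_div hα₀).2 hα₁.le
  rw [hint.integral_loss] at h1
  rw [← hm, Market.objective]
  simp only at h1 ⊢
  nlinarith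

/-- Scaling a minimizer gives `≤`; the same bound for `c⁻¹` gives `≥`. At `c = 0` the bound by the
mean is needed instead. -/
theorem Market.risk_smul {c : ℝ} (hc : 0 ≤ c) (π : Fin d → ℝ) :
    M.risk P α (c • π) = c * M.risk P α π := by
  have key (c : ℝ) (hc : 0 ≤ c) (π : Fin d → ℝ) : M.risk P α (c • π) ≤ c * M.risk P α π := by
    obtain ⟨m, hm⟩ := M.exists_objective_eq_risk hint hα₀ hα₁ π
    rw [← hm, ← M.objective_smul hc]
    exact M.risk_le_objective hint hα₀ hα₁ (c • (m, π))
  refine le_antisymm (key c hc π) ?_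
  rcases hc.eq_or_lt with rfl | hc
  · simpa using M.neg_mean_le_risk hint hα₀ hα₁ 0
  · have h1 := key c⁻¹ (inv_nonneg.2 hc.le) (c • π)
    rw [inv_smul_smul₀ hc.ne'] at h1
    calc c * M.risk P α π ≤ c * (c⁻¹ * M.risk P α (c • π)) := by gcongr
      _ = M.risk P α (c • π) := by field_simp

/-- A nonzero portfolio with mean excess return zero has positive risk. -/
theorem Market.risk_pos_of_mean_eq_zero (hnonred : M.Nonredundant P) {π : Fin d → ℝ} (hπ : π ≠ 0)
    (h0 : M.mean P π = 0) : 0 < M.risk P α π := by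
  by_contra! hle
  refine hπ (hnonred.eq_zero ?_)
  obtain ⟨m, hm⟩ := M.exists_objective_eq_risk hint hα₀ hα₁ π
  have h1 : ∫ ω, M.loss (m, π) ω ∂P ≤ ∫ ω, max (M.loss (m, π) ω) 0 ∂P :=
    integral_mono (hint.loss _) (hint.loss _).pos_part fun ω => le_max_left _ _
  have h2 : 0 ≤ ∫ ω, max (M.loss (m, π) ω) 0 ∂P := integral_nonneg fun ω => le_max_right _ _
  have h3 : 1 < 1 / α := (one_lt_div hα₀).2 hα₁
  rw [hint.integral_loss] at h1
  rw [← hm, Market.objective] at hle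
  simp only [h0] at h1 hle
  -- Mean zero gives `E[L⁺] ≥ -m`, so risk at most zero forces `(1/α - 1) * E[L⁺] ≤ 0`. Then `m = 0`
  -- and `X_π ≥ 0` has mean zero.
  have h4 : ∫ ω, max (M.loss (m, π) ω) 0 ∂P = 0 := by nlinarith
  rw [h4] at h1 hle
  obtain rfl : m = 0 := by linarith
  have h5 := (integral_eq_zero_iff_of_nonneg (fun ω => le_max_right _ _)
    (hint.loss (0, π)).pos_part).1 h4
  have h6 : 0 ≤ᵐ[P] M.excess π := by
    filter_upwards [h5] with ω hω
    have := (le_max_left (M.loss (0, π) ω) 0).trans_eq hω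
    simp only [Market.loss, LinearMap.coe_mk, AddHom.coe_mk, Pi.zero_apply] at this ⊢
    linarith
  exact (integral_eq_zero_iff_of_nonneg_ae h6 (hint.excess π)).1
    ((hint.integral_excess π).trans h0)

end Risk

end Loss

/-! ### Martingale densities and the sign of the risk -/

section Duality

variable {Ω : Type*} [MeasurableSpace Ω] {P : Measure Ω} {d : ℕ}
  {M : Market Ω d} {α : ℝ}

theorem Market.loss_apply (v : ℝ × (Fin d → ℝ)) (ω : Ω) :
    M.loss v ω = -M.excess v.2 ω - v.1 := rfl

/-- Pricing with a martingale density: the loss `-X_π - m` has price `-m`. -/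
theorem Market.integral_acmmDensity_mul_loss {Z : Ω → ℝ} (hZ : Z ∈ M.acmmDensities P)
    (v : ℝ × (Fin d → ℝ)) :
    Integrable (fun ω => Z ω * M.loss v ω) P ∧ ∫ ω, Z ω * M.loss v ω ∂P = -v.1 := by
  obtain ⟨⟨hZi, -, hZ1⟩, hmart⟩ := hZ
  have hterm (i : Fin d) : Integrable (fun ω => v.2 i * (Z ω * (M.ret i ω - M.r))) P :=
    (hmart i).1.const_mul _
  have hsum : Integrable (fun ω => ∑ i, v.2 i * (Z ω * (M.ret i ω - M.r))) P :=
    integrable_finsetSum _ fun i _ => hterm i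
  have heq : (fun ω => Z ω * M.loss v ω) = fun ω =>
      -(∑ i, v.2 i * (Z ω * (M.ret i ω - M.r))) - Z ω * v.1 := by
    ext ω
    rw [Market.loss_apply, Market.excess, mul_sub, mul_neg, Finset.mul_sum]
    simp only [mul_left_comm]
  rw [heq]
  have hneg : Integrable (fun ω => -∑ i, v.2 i * (Z ω * (M.ret i ω - M.r))) P := hsum.neg
  refine ⟨hneg.sub (hZi.mul_const _), ?_⟩
  rw [integral_sub hneg (hZi.mul_const _), integral_neg, integral_finsetSum _ fun i _ => hterm i,
    integral_mul_const, hZ1]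
  simp [integral_const_mul, (hmart _).2]

variable [IsProbabilityMeasure P]

/-- A bounded nonnegative function that prices all losses correctly is a martingale density. -/
theorem Market.IntegrableReturns.mem_acmmDensities (hint : M.IntegrableReturns P) {Z : Ω → ℝ}
    {b : ℝ} (hZ : Integrable Z P) (h0 : ∀ᵐ ω ∂P, 0 ≤ Z ω) (hb : ∀ᵐ ω ∂P, Z ω ≤ b)
    (hrep : ∀ v, ∫ ω, Z ω * M.loss v ω ∂P = -v.1) : Z ∈ M.acmmDensities P := by
  refine ⟨⟨hZ, h0, ?_⟩, fun i => ⟨?_, ?_⟩⟩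
  -- The pair `(1, 0)` tests the total mass; `(0, Pi.single i 1)` below tests the martingale
  -- property of asset `i`.
  · have h := hrep (1, 0)
    simp only [Market.loss_apply, Market.excess, Pi.zero_apply, zero_mul, Finset.sum_const_zero,
      neg_zero, zero_sub, mul_neg, mul_one, integral_neg] at h
    linarith
  · refine ((hint i).sub (integrable_const _)).bdd_mul hZ.aestronglyMeasurable (c := b) ?_
    filter_upwards [h0, hb] with ω h0 h1
    rwa [Real.norm_eq_abs, abs_of_nonneg h0]
  · have h := hrep (0, Pi.single i 1)
    have hl (ω : Ω) : M.loss (0, Pi.single i 1) ω = -(M.ret i ω - M.r) := by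
      simp [Market.loss_apply, Market.excess, Pi.single_apply]
    simpa only [hl, mul_neg, integral_neg, neg_inj, neg_zero, neg_eq_zero] using h

variable (hint : M.IntegrableReturns P) (hα₀ : 0 < α) (hα₁ : α < 1)
include hint

/-- The gap between the Rockafellar–Uryasev objective and the price of the loss. -/
theorem Market.objective_eq_integral {Z : Ω → ℝ} (hZ : Z ∈ M.acmmDensities P)
    (v : ℝ × (Fin d → ℝ)) :
    M.objective P α v = ∫ ω, (1 / α * max (M.loss v ω) 0 - Z ω * M.loss v ω) ∂P := by
  obtain ⟨hi, hp⟩ := M.integral_acmmDensity_mul_loss hZ v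
  rw [integral_sub ((hint.loss v).pos_part.const_mul _) hi, hp, integral_const_mul,
    Market.objective]
  ring

include hα₀ hα₁

/-- Nonnegativity of Expected Shortfall is equivalent to the existence of a martingale density
bounded by `1 / α`. -/
theorem Market.forall_risk_nonneg_iff :
    (∀ π, 0 ≤ M.risk P α π) ↔
      ∃ Z ∈ M.acmmDensities P, eLpNorm Z ⊤ P ≤ ENNReal.ofReal (1 / α) := by
  constructor
  · intro h
    obtain ⟨Z, hZ, h0, hb, hrep⟩ := exists_density_of_forall_integral_le M.loss hint.loss
      (-LinearMap.fst ℝ ℝ (Fin d → ℝ)) (one_div_nonneg.2 hα₀.le) fun v => by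
        have := (h v.2).trans (M.risk_le_objective hint hα₀ hα₁ v)
        rw [Market.objective] at this
        simp only [LinearMap.neg_apply, LinearMap.fst_apply]
        linarith
    refine ⟨Z, hint.mem_acmmDensities hZ h0 hb hrep, ?_⟩
    rw [eLpNorm_exponent_top]
    refine eLpNormEssSup_le_of_ae_bound ?_
    filter_upwards [h0, hb] with ω h0 h1
    rwa [Real.norm_eq_abs, abs_of_nonneg h0]
  · rintro ⟨Z, hZ, hle⟩ π
    obtain ⟨m, hm⟩ := M.exists_objective_eq_risk hint hα₀ hα₁ π
    rw [← hm, M.objective_eq_integral hint hZ]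
    refine integral_nonneg_of_ae ?_
    rw [eLpNorm_exponent_top] at hle
    filter_upwards [ae_le_eLpNormEssSup (f := Z) (μ := P), hZ.1.2.1] with ω h1 h0
    have h2 : Z ω ≤ 1 / α := by
      have := h1.trans hle
      rw [Real.enorm_eq_ofReal h0] at this
      exact (ENNReal.ofReal_le_ofReal_iff (one_div_nonneg.2 hα₀.le)).1 this
    rw [Pi.zero_apply, sub_nonneg]
    calc Z ω * M.loss (m, π) ω ≤ Z ω * max (M.loss (m, π) ω) 0 := by
          gcongr
          exact le_max_left _ _
      _ ≤ 1 / α * max (M.loss (m, π) ω) 0 := by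
          gcongr

/-- The Rockafellar–Uryasev objective is positive off zero when Expected Shortfall is. -/
theorem Market.objective_pos (h : ∀ π, π ≠ 0 → 0 < M.risk P α π) {v : ℝ × (Fin d → ℝ)}
    (hv : v ≠ 0) : 0 < M.objective P α v := by
  rcases eq_or_ne v.2 0 with h2 | h2
  · have h1 : v.1 ≠ 0 := fun h1 => hv (Prod.ext h1 h2)
    have hα : 1 < 1 / α := (one_lt_div hα₀).2 hα₁
    have hl : M.objective P α v = v.1 + 1 / α * max (-v.1) 0 := by
      simp [Market.objective, Market.loss_apply, Market.excess, h2]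
    rw [hl]
    rcases h1.lt_or_gt with h1 | h1
    · rw [max_eq_left (by linarith)]
      nlinarith
    · rw [max_eq_right (by linarith)]
      linarith
  · exact (h _ h2).trans_le (M.risk_le_objective hint hα₀ hα₁ v)

/-- Positivity of Expected Shortfall off zero is equivalent to the existence of an equivalent
martingale density with essential supremum less than `1 / α`. -/
theorem Market.forall_risk_pos_iff (hnonred : M.Nonredundant P) :
    (∀ π, π ≠ 0 → 0 < M.risk P α π) ↔
      ∃ Z ∈ M.emmDensities P, eLpNorm Z ⊤ P < ENNReal.ofReal (1 / α) := by
  have hα : 0 < 1 / α := one_div_pos.2 hα₀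
  constructor
  · intro h
    -- The margin `c * ‖v‖` in the domination inequality, to be spent on moving the density off its
    -- bounds.
    obtain ⟨c, hc, hcF⟩ := exists_mul_norm_le_of_sublinear
      (hint.objective_add_le (P := P) hα₀) (fun c hc v => M.objective_smul (P := P) hc v) ⊤
      fun v _ hv => M.objective_pos hint hα₀ hα₁ h hv
    let T := LinearMap.toContinuousLinearMap (toL1Lin M.loss hint.loss)
    have hT (v : ℝ × (Fin d → ℝ)) : ∫ ω, ‖M.loss v ω‖ ∂P ≤ ‖T‖ * ‖v‖ := by
      rw [← L1.norm_of_fun_eq_integral_norm (hf := hint.loss v)]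
      exact T.le_opNorm v
    -- Lowering the bound `1/α` by `2ε` costs at most `2ε‖T‖‖v‖`, and subtracting `ε * E[L]` from
    -- the functional costs at most `ε‖T‖‖v‖`.
    obtain ⟨ε, hε, hεc, hεα⟩ : ∃ ε : ℝ, 0 < ε ∧ 3 * ε * ‖T‖ ≤ c ∧ 2 * ε ≤ 1 / α := by
      refine ⟨min (c / (3 * (‖T‖ + 1))) (1 / α / 2), by positivity, ?_, ?_⟩
      · calc 3 * min (c / (3 * (‖T‖ + 1))) (1 / α / 2) * ‖T‖
            ≤ 3 * (c / (3 * (‖T‖ + 1))) * (‖T‖ + 1) := by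
              gcongr
              · exact min_le_left _ _
              · linarith
          _ = c := by field_simp
      · linarith [min_le_right (c / (3 * (‖T‖ + 1))) (1 / α / 2)]
    -- What remains of the price `-m` once the constant density `ε` has priced its share; `ε + Z`
    -- will then be the density sought, with values in `[ε, 1/α - ε]`.
    let l : (ℝ × (Fin d → ℝ)) →ₗ[ℝ] ℝ :=
      -LinearMap.fst ℝ ℝ (Fin d → ℝ) + ε • (M.mean P ∘ₗ LinearMap.snd ℝ ℝ (Fin d → ℝ) +
        LinearMap.fst ℝ ℝ (Fin d → ℝ))
    have hl (v : ℝ × (Fin d → ℝ)) : l v = -v.1 - ε * ∫ ω, M.loss v ω ∂P := by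
      simp only [l, hint.integral_loss, LinearMap.add_apply, LinearMap.neg_apply,
        LinearMap.smul_apply, LinearMap.comp_apply, LinearMap.fst_apply, LinearMap.snd_apply,
        smul_eq_mul]
      ring
    obtain ⟨Z, hZ, h0, hb, hrep⟩ := exists_density_of_forall_integral_le M.loss hint.loss
      l (sub_nonneg.2 hεα) fun v => by
        have h1 := hcF v trivial
        have h2 := hT v
        have h3 : ∫ ω, max (M.loss v ω) 0 ∂P ≤ ∫ ω, ‖M.loss v ω‖ ∂P :=
          integral_mono (hint.loss v).pos_part (hint.loss v).norm fun ω =>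
            max_le (le_abs_self _) (abs_nonneg _)
        have h4 : -∫ ω, M.loss v ω ∂P ≤ ∫ ω, ‖M.loss v ω‖ ∂P :=
          (neg_le_abs _).trans (norm_integral_le_integral_norm (M.loss v))
        have h5 : 3 * ε * ‖T‖ * ‖v‖ ≤ c * ‖v‖ := by gcongr
        rw [Market.objective] at h1
        rw [hl]
        nlinarith
    have hbd : ∀ᵐ ω ∂P, ε + Z ω ≤ 1 / α - ε := by
      filter_upwards [hb] with ω h1
      linarith
    have hpos : ∀ᵐ ω ∂P, 0 < ε + Z ω := by
      filter_upwards [h0] with ω h0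
      linarith
    refine ⟨fun ω => ε + Z ω, ⟨hint.mem_acmmDensities ((integrable_const ε).add hZ)
      (hpos.mono fun _ => le_of_lt) hbd fun v => ?_, hpos⟩, ?_⟩
    · have hi : Integrable (fun ω => Z ω * M.loss v ω) P := by
        refine (hint.loss v).bdd_mul hZ.aestronglyMeasurable (c := 1 / α - 2 * ε) ?_
        filter_upwards [h0, hb] with ω h0 h1
        rwa [Real.norm_eq_abs, abs_of_nonneg h0]
      simp only [add_mul]
      rw [integral_add ((hint.loss v).const_mul ε) hi, hrep, integral_const_mul, hl]
      ring
    · rw [eLpNorm_exponent_top]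
      refine (eLpNormEssSup_le_of_ae_bound (C := 1 / α - ε) ?_).trans_lt
        ((ENNReal.ofReal_lt_ofReal_iff hα).2 (by linarith))
      filter_upwards [hpos, hbd] with ω h0 h1
      rwa [Real.norm_eq_abs, abs_of_pos h0]
  · rintro ⟨Z, ⟨hZ, hZpos⟩, hlt⟩ π hπ
    by_contra! hle
    obtain ⟨m, hm⟩ := M.exists_objective_eq_risk hint hα₀ hα₁ π
    obtain ⟨hi, hprice⟩ := M.integral_acmmDensity_mul_loss hZ (m, π)
    have hZlt : ∀ᵐ ω ∂P, Z ω < 1 / α := by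
      rw [eLpNorm_exponent_top] at hlt
      filter_upwards [ae_le_eLpNormEssSup (f := Z) (μ := P), hZpos] with ω h1 h0
      have := h1.trans_lt hlt
      rw [Real.enorm_eq_ofReal h0.le] at this
      exact (ENNReal.ofReal_lt_ofReal_iff hα).1 this
    have hnn : 0 ≤ᵐ[P] fun ω => 1 / α * max (M.loss (m, π) ω) 0 - Z ω * M.loss (m, π) ω := by
      filter_upwards [hZlt, hZpos] with ω h1 h0
      rw [Pi.zero_apply, sub_nonneg]
      calc Z ω * M.loss (m, π) ω ≤ Z ω * max (M.loss (m, π) ω) 0 := by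
            gcongr
            exact le_max_left _ _
        _ ≤ 1 / α * max (M.loss (m, π) ω) 0 := by
            gcongr
    rw [← hm, M.objective_eq_integral hint hZ] at hle
    have hzero := (integral_eq_zero_iff_of_nonneg_ae hnn
      (((hint.loss (m, π)).pos_part.const_mul _).sub hi)).1
      (le_antisymm hle (integral_nonneg_of_ae hnn))
    -- `Z > 0` rules out negative losses and `Z < 1/α` positive ones.
    have hloss : ∀ᵐ ω ∂P, M.loss (m, π) ω = 0 := by
      filter_upwards [hzero, hZlt, hZpos] with ω h h1 h0
      rw [Pi.zero_apply] at h
      rcases lt_trichotomy (M.loss (m, π) ω) 0 with hneg | h2 | h2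
      · rw [max_eq_right hneg.le] at h
        nlinarith
      · exact h2
      · rw [max_eq_left h2.le] at h
        nlinarith
    have hm0 : m = 0 := by
      have : ∫ ω, Z ω * M.loss (m, π) ω ∂P = 0 := by
        rw [← integral_zero Ω ℝ (μ := P)]
        refine integral_congr_ae ?_
        filter_upwards [hloss] with ω h
        rw [h, mul_zero]
      rw [hprice] at this
      exact neg_eq_zero.1 this
    refine hπ (hnonred.eq_zero ?_)
    filter_upwards [hloss] with ω h
    rw [Market.loss_apply, hm0] at h
    simp only at h
    linarith

end Duality

/-! ### Arbitrage criteria and optimal portfolios -/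

section Arbitrage

variable {Ω : Type*} [MeasurableSpace Ω] {P : Measure Ω} [IsProbabilityMeasure P] {d : ℕ}
  {M : Market Ω d} {α : ℝ} (hint : M.IntegrableReturns P) (hα₀ : 0 < α) (hα₁ : α < 1)
include hint

/-- The set of optimal portfolios, in terms of real-valued risk and mean. -/
theorem Market.optimalSet_eq (ν : ℝ) :
    M.optimalSet P (ES P α) ν =
      {π | M.mean P π = ν ∧ ∀ π', M.mean P π' = ν → M.risk P α π ≤ M.risk P α π'} := by
  ext π
  simp [Market.optimalSet, Market.portfolios, hint.integral_excess, Market.ES_excess]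

include hα₀ hα₁

/-- Strong arbitrage is excluded exactly when no portfolio has negative risk. -/
theorem Market.not_strongArbitrage_iff :
    ¬ M.StrongArbitrage P (ES P α) ↔ ∀ π, 0 ≤ M.risk P α π := by
  have hr0 : M.risk P α 0 = 0 := by simpa using M.risk_smul hint hα₀ hα₁ le_rfl 0
  simp only [Market.StrongArbitrage, hint.integral_excess, Market.ES_excess,
    EReal.coe_lt_coe_iff]
  constructor
  · intro h π
    by_contra! hneg
    -- Adding `π` lowers the risk by subadditivity and raises the mean, which is at least minus the
    -- risk of `π`.
    refine h fun π' => ⟨π' + π, ?_, ?_⟩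
    · rw [map_add]
      linarith [M.neg_mean_le_risk hint hα₀ hα₁ π]
    · linarith [M.risk_add_le hint hα₀ hα₁ π' π]
  · intro h hs
    obtain ⟨π, -, hπ⟩ := hs 0
    linarith [h π]

/-- Arbitrage is excluded exactly when every nonzero portfolio has positive risk. -/
theorem Market.not_arbitrage_iff (hnonred : M.Nonredundant P) :
    ¬ M.Arbitrage P (ES P α) ↔ ∀ π, π ≠ 0 → 0 < M.risk P α π := by
  have hr0 : M.risk P α 0 = 0 := by simpa using M.risk_smul hint hα₀ hα₁ le_rfl 0
  simp only [Market.Arbitrage, not_not, Market.Efficient, Market.StrictlyPreferred,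
    hint.integral_excess, Market.ES_excess, EReal.coe_lt_coe_iff, EReal.coe_le_coe_iff]
  constructor
  · rintro ⟨π, -, hπ⟩ η hη
    by_contra! hle
    have h1 := M.neg_mean_le_risk hint hα₀ hα₁ η
    have h2 : M.mean P η ≠ 0 := fun h0 =>
      hle.not_gt (M.risk_pos_of_mean_eq_zero hint hα₀ hα₁ hnonred hη h0)
    have h3 : 0 < M.mean P η := lt_of_le_of_ne (by linarith) h2.symm
    refine hπ ⟨π + η, ?_, ?_, Or.inl ?_⟩
    · rw [map_add]
      linarith
    · linarith [M.risk_add_le hint hα₀ hα₁ π η]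
    · rw [map_add]
      linarith
  · intro h
    -- The riskless position is efficient: any other portfolio has larger risk.
    refine ⟨0, by rw [map_zero], ?_⟩
    rintro ⟨π, -, h2, h3⟩
    rcases eq_or_ne π 0 with rfl | hπ
    · simp at h3
    · linarith [h π hπ]

theorem Market.convex_optimalSet (ν : ℝ) : Convex ℝ (M.optimalSet P (ES P α) ν) := by
  rw [M.optimalSet_eq hint]
  intro π hπ η hη a b ha hb hab
  refine ⟨?_, fun π' hπ' => ?_⟩
  · rw [map_add, map_smul, map_smul, hπ.1, hη.1, ← add_smul, hab, one_smul]
  · calc M.risk P α (a • π + b • η) ≤ M.risk P α (a • π) + M.risk P α (b • η) :=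
          M.risk_add_le hint hα₀ hα₁ _ _
      _ = a * M.risk P α π + b * M.risk P α η := by
          rw [M.risk_smul hint hα₀ hα₁ ha, M.risk_smul hint hα₀ hα₁ hb]
      _ ≤ a * M.risk P α π' + b * M.risk P α π' :=
          add_le_add (mul_le_mul_of_nonneg_left (hπ.2 _ hπ') ha)
            (mul_le_mul_of_nonneg_left (hη.2 _ hπ') hb)
      _ = M.risk P α π' := by rw [← add_mul, hab, one_mul]

/-- In a nonredundant and nondegenerate market, optimal portfolios exist and form a compact set. -/
theorem Market.optimalSet_nonempty_and_isCompact (hnonred : M.Nonredundant P)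
    (hnondeg : M.Nondegenerate P) (ν : ℝ) :
    (M.optimalSet P (ES P α) ν).Nonempty ∧ IsCompact (M.optimalSet P (ES P α) ν) := by
  have hcont : Continuous (M.risk P α) := continuous_of_sublinear
    (M.risk_add_le hint hα₀ hα₁) fun c hc π => M.risk_smul hint hα₀ hα₁ hc π
  have hmean : Continuous (M.mean P) := LinearMap.continuous_of_finiteDimensional _
  -- Nondegeneracy makes `Π_ν` nonempty: scale an asset whose mean return differs from `r`.
  obtain ⟨π₀, h₀⟩ : ∃ π, M.mean P π = ν := by
    obtain ⟨i, hi⟩ := hnondeg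
    have h1 : M.mean P (Pi.single i 1) = ∫ ω, M.ret i ω ∂P - M.r := by
      rw [← hint.integral_excess]
      simp only [Market.excess, Pi.single_apply, ite_mul, one_mul, zero_mul,
        Finset.sum_ite_eq', Finset.mem_univ, if_true]
      rw [integral_sub (hint i) (integrable_const _)]
      simp
    have h2 : ∫ ω, M.ret i ω ∂P - M.r ≠ 0 := sub_ne_zero.2 hi
    refine ⟨(ν / (∫ ω, M.ret i ω ∂P - M.r)) • Pi.single i 1, ?_⟩
    rw [map_smul, h1, smul_eq_mul, div_mul_cancel₀ _ h2]
  obtain ⟨c, hc, hcoer⟩ := exists_mul_norm_le_of_sublinear (M.risk_add_le hint hα₀ hα₁)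
    (fun c hc π => M.risk_smul hint hα₀ hα₁ hc π) (LinearMap.ker (M.mean P)) fun π hπ hne =>
      M.risk_pos_of_mean_eq_zero hint hα₀ hα₁ hnonred hne hπ
  set K : Set (Fin d → ℝ) := {π | M.mean P π = ν ∧ M.risk P α π ≤ M.risk P α π₀}
  have hKclosed : IsClosed K :=
    (isClosed_eq hmean continuous_const).inter (isClosed_le hcont continuous_const)
  have hKcomp : IsCompact K := by
    -- Differences of portfolios in `Π_ν` lie in the kernel of the mean, where the risk is coercive;
    -- the radius comes from `c * ‖π - π₀‖ ≤ risk π + risk (-π₀)`.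
    refine (isCompact_closedBall π₀
      ((M.risk P α π₀ + M.risk P α (-π₀)) / c)).of_isClosed_subset hKclosed fun π hπ => ?_
    rw [Metric.mem_closedBall, dist_eq_norm, le_div_iff₀ hc, mul_comm]
    have h1 := hcoer (π - π₀) (by rw [LinearMap.mem_ker, map_sub, hπ.1, h₀, sub_self])
    have h2 := M.risk_add_le hint hα₀ hα₁ π (-π₀)
    rw [← sub_eq_add_neg] at h2
    linarith [hπ.2]
  obtain ⟨η, hη, hmin⟩ := hKcomp.exists_isMinOn ⟨π₀, h₀, le_rfl⟩ hcont.continuousOn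
  rw [M.optimalSet_eq hint]
  refine ⟨⟨η, hη.1, fun π' hπ' => ?_⟩, hKcomp.of_isClosed_subset ?_ fun π hπ =>
    ⟨hπ.1, hπ.2 _ h₀⟩⟩
  · rcases le_total (M.risk P α π') (M.risk P α π₀) with h | h
    · exact hmin (show π' ∈ K from ⟨hπ', h⟩)
    · exact hη.2.trans h
  · have : {π | M.mean P π = ν ∧ ∀ π', M.mean P π' = ν → M.risk P α π ≤ M.risk P α π'} =
        {π | M.mean P π = ν} ∩ ⋂ π', ⋂ (_ : M.mean P π' = ν),
          {π | M.risk P α π ≤ M.risk P α π'} := by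
      ext π
      simp
    rw [this]
    exact (isClosed_eq hmean continuous_const).inter
      (isClosed_iInter fun π' => isClosed_iInter fun _ => isClosed_le hcont continuous_const)

end Arbitrage

end MeanRisk


theorem mainTheorem4 {Ω : Type*} [MeasurableSpace Ω] (P : Measure Ω) [IsProbabilityMeasure P]
    {d : ℕ} (M : MeanRisk.Market Ω d) (hnonred : M.Nonredundant P)
    (hint : M.IntegrableReturns P) (hnondeg : M.Nondegenerate P)
    (α : ℝ) (hα₀ : 0 < α) (hα₁ : α < 1) :
    (∀ ν : ℝ, 0 ≤ ν →
      (M.optimalSet P (MeanRisk.ES P α) ν).Nonempty ∧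
      IsCompact (M.optimalSet P (MeanRisk.ES P α) ν) ∧
      Convex ℝ (M.optimalSet P (MeanRisk.ES P α) ν)) ∧
    (¬ M.StrongArbitrage P (MeanRisk.ES P α) ↔
      ∃ Z ∈ M.acmmDensities P, eLpNorm Z ⊤ P ≤ ENNReal.ofReal (1 / α)) ∧
    (¬ M.Arbitrage P (MeanRisk.ES P α) ↔
      ∃ Z ∈ M.emmDensities P, eLpNorm Z ⊤ P < ENNReal.ofReal (1 / α)) := by
  refine ⟨fun ν _ => ?_, ?_, ?_⟩
  · obtain ⟨h1, h2⟩ :=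
      M.optimalSet_nonempty_and_isCompact hint hα₀ hα₁ hnonred hnondeg ν
    exact ⟨h1, h2, M.convex_optimalSet hint hα₀ hα₁ ν⟩
  · exact (M.not_strongArbitrage_iff hint hα₀ hα₁).trans (M.forall_risk_nonneg_iff hint hα₀ hα₁)
  · exact (M.not_arbitrage_iff hint hα₀ hα₁ hnonred).trans
      (M.forall_risk_pos_iff hint hα₀ hα₁ hnonred)
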